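/- Let $\alpha\in[0,1]$, $c>0$, and let $\mu^-,\mu^+$ be finite Borel measures on $\mathbb R^m$ of equal total mass. A rectifiable $1$-current $T=\underline{\underline{\tau}}(M,\theta,\xi)$ in $\mathbb R^m$ consists of a countably $1$-rectifiable, $\mathcal H^1$-measurable set $M$, a nonnegative locally $\mathcal H^1$-integrable density $\theta$ on $M$, and an $\mathcal H^1$-measurable unit vector field $\xi$ on $M$ that is tangent to $M$ at $\mathcal H^1$-almost every point; it acts on smooth compactly supported $1$-forms by $T(\omega)=\int_M\langle\omega(x),\xi(x)\rangle\,\theta(x)\,d\mathcal H^1(x)$. Let $Path(\mu^-,\mu^+)$ be the set of all such $T$ with $\partial T=\mu^+-\mu^-$, that is, $T(df)=\int f\,d\mu^+-\int f\,d\mu^-$ for all $f\in C_c^\infty(\mathbb R^m)$. Put $$\mathbf M_{\alpha,c}(T)=c^\alpha\int_M H_{c,\alpha}(\theta(x))\,d\mathcal H^1(x),\qquad H_{c,\alpha}(x)=\Big\lfloor\frac xc\Big\rfloor+\Big(\frac xc-\Big\lfloor\frac xc\Big\rfloor\Big)^{\alpha},$$ with the convention $0^0=0$, so that $H_{c,\alpha}(nc)=n$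 for every integer $n$ and every $\alpha\in[0,1]$. Let $T=\underline{\underline{\tau}}(M,\theta,\xi)\in Path(\mu^-,\mu^+)$ be optimal, i.e. $\mathbf M_{\alpha,c}(T)\le\mathbf M_{\alpha,c}(S)$ for all $S\in Path(\mu^-,\mu^+)$, and suppose $\mathbf M_{\alpha,c}(T)<\infty$. Let $v_1,v_2\in M$ and let $\gamma_0:[0,1]\to M$ be a regular curve from $v_1$ to $v_2$: $\gamma_0$ is continuous on $[0,1]$, $C^1$ on $(0,1)$, $\gamma_0'(t)\neq0$ for $t\in(0,1)$, $\gamma_0(0)=v_1$, $\gamma_0(1)=v_2$. Suppose that the orientation $\xi$ of $T$ reverses at most finitely often along $\gamma_0$: there is a finite set $F$ such that every $t\in(0,1)\setminus F$ has a neighbourhood in which either $\langle\xi(\gamma_0(s)),\gamma_0'(s)\rangle>0$ for almost every $s$, or $\langle\xi(\gamma_0(s)),\gamma_0'(s)\rangle<0$ for almost every $s$. (This holds in particular if $\gamma_0$ runs in the direction of $\xi$.) If the minimum $$\theta_0=\min\Big\{\frac{\theta(\gamma_0(t))}{c}:t\in[0,1]\Big\}$$ exists and is a positive integer, then $\gamma_0([0,1])=\overline{v_1v_2}$,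 where $\overline{v_1v_2}=\{(1-t)v_1+tv_2: t\in[0,1]\}$. -/

import Mathlib

open Set MeasureTheory
open scoped ENNReal

/-- `ξ` is a unit tangent field of the set `M`, and `M` is countably 1-rectifiable: up to an
`H¹`-null set, `M` is covered by countably many regular `C¹` curves, and at `H¹`-almost every
point of `M` the vector `ξ x` is a unit vector tangent to a curve of this cover. -/
def IsUnitTangentField {m : ℕ} (M : Set (EuclideanSpace ℝ (Fin m)))
    (ξ : EuclideanSpace ℝ (Fin m) → EuclideanSpace ℝ (Fin m)) : Prop :=
  ∃ f : ℕ → ℝ → EuclideanSpace ℝ (Fin m),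
    (∀ i, ContDiff ℝ 1 (f i) ∧ ∀ t, deriv (f i) t ≠ 0) ∧
    ∀ᵐ x ∂((Measure.hausdorffMeasure 1).restrict M),
      ‖ξ x‖ = 1 ∧ ∃ i t, f i t = x ∧ ξ x ∈ Submodule.span ℝ {deriv (f i) t}

/-- A (real) rectifiable 1-current `τ(M, θ, ξ)` in `ℝᵐ`: a countably 1-rectifiable,
`H¹`-measurable set `M`, a nonnegative locally `H¹`-integrable density `θ` on `M`, and an
`H¹`-measurable orientation `ξ` of the approximate tangent lines of `M`. -/
structure RectifiableCurrent (m : ℕ) where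
  /-- the set `M` -/
  carrier : Set (EuclideanSpace ℝ (Fin m))
  /-- the density `θ` -/
  density : EuclideanSpace ℝ (Fin m) → ℝ
  /-- the orientation `ξ` -/
  orient : EuclideanSpace ℝ (Fin m) → EuclideanSpace ℝ (Fin m)
  nullMeasurableSet_carrier :
    NullMeasurableSet carrier (Measure.hausdorffMeasure 1)
  density_nonneg : ∀ x ∈ carrier, 0 ≤ density x
  locallyIntegrable_density :
    LocallyIntegrable density ((Measure.hausdorffMeasure 1).restrict carrier)
  aestronglyMeasurable_orient :
    AEStronglyMeasurable orient ((Measure.hausdorffMeasure 1).restrict carrier)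
  isUnitTangentField : IsUnitTangentField carrier orient

namespace RectifiableCurrent

variable {m : ℕ}

/-- The action of `τ(M, θ, ξ)` on a 1-form `φ`: `∫_M ⟨φ(x), ξ(x)⟩ θ(x) dH¹(x)`. -/
noncomputable def eval (T : RectifiableCurrent m)
    (φ : EuclideanSpace ℝ (Fin m) → EuclideanSpace ℝ (Fin m) →L[ℝ] ℝ) : ℝ :=
  ∫ x in T.carrier, T.density x * φ x (T.orient x) ∂(Measure.hausdorffMeasure 1)

/-- The boundary `∂T(f) = T(df)`. -/
noncomputable def boundary (T : RectifiableCurrent m)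
    (f : EuclideanSpace ℝ (Fin m) → ℝ) : ℝ :=
  T.eval (fun x => fderiv ℝ f x)

/-- `T ∈ Path(μ⁻, μ⁺)`, that is, `∂T = μ⁺ - μ⁻` as functionals on smooth compactly supported
functions. -/
def IsTransportPath (μm μp : Measure (EuclideanSpace ℝ (Fin m)))
    (T : RectifiableCurrent m) : Prop :=
  ∀ f : EuclideanSpace ℝ (Fin m) → ℝ, ContDiff ℝ (⊤ : ℕ∞) f → HasCompactSupport f →
    T.boundary f = ∫ x, f x ∂μp - ∫ x, f x ∂μm

end RectifiableCurrent

/-- `H_{c,α}(x) = ⌊x/c⌋ + (x/c - ⌊x/c⌋)^α`, where the power of a vanishing fractional part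
is `0`, also for `α = 0`, so that `H_{c,α}(n c) = n` for every integer `n` and `α ∈ [0,1]`. -/
noncomputable def capacityCost (α c x : ℝ) : ℝ :=
  (⌊x / c⌋ : ℝ) + if Int.fract (x / c) = 0 then 0 else Int.fract (x / c) ^ α

namespace RectifiableCurrent

variable {m : ℕ}

/-- The cost `M_{α,c}(T) = c^α ∫_M H_{c,α}(θ(x)) dH¹(x) ∈ [0,∞]`. -/
noncomputable def cost (α c : ℝ) (T : RectifiableCurrent m) : ℝ≥0∞ :=
  ENNReal.ofReal (c ^ α) *
    ∫⁻ x in T.carrier, ENNReal.ofReal (capacityCost α c (T.density x))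
      ∂(Measure.hausdorffMeasure 1)

/-- `T` minimizes `M_{α,c}` in `Path(μ⁻, μ⁺)`. -/
def IsOptimal (α c : ℝ) (μm μp : Measure (EuclideanSpace ℝ (Fin m)))
    (T : RectifiableCurrent m) : Prop :=
  T.IsTransportPath μm μp ∧
    ∀ S : RectifiableCurrent m, S.IsTransportPath μm μp → T.cost α c ≤ S.cost α c

/-- `Γ(v₁, v₂)`: the curves `γ : [0,1] → M` from `v₁` to `v₂` that are regular, i.e. continuous
on `[0,1]` and `C¹` with nonvanishing derivative on `(0,1)`. -/
def regularCurves (T : RectifiableCurrent m) (v₁ v₂ : EuclideanSpace ℝ (Fin m)) :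
    Set (ℝ → EuclideanSpace ℝ (Fin m)) :=
  {γ | ContinuousOn γ (Icc 0 1) ∧ ContDiffOn ℝ 1 γ (Ioo 0 1) ∧ MapsTo γ (Icc 0 1) T.carrier ∧
    γ 0 = v₁ ∧ γ 1 = v₂ ∧ ∀ t ∈ Ioo (0 : ℝ) 1, deriv γ t ≠ 0}

/-- Apart from finitely many parameters, the curve `γ` runs, near each parameter `t`, either
with the orientation `ξ` of `T` or against it (at almost every parameter near `t`). -/
def ReversesFinitelyOften (T : RectifiableCurrent m)
    (γ : ℝ → EuclideanSpace ℝ (Fin m)) : Prop :=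
  ∃ F : Set ℝ, F.Finite ∧ ∀ t ∈ Ioo (0 : ℝ) 1 \ F, ∃ δ > 0,
    (∀ᵐ s : ℝ, s ∈ Ioo (0 : ℝ) 1 → |s - t| < δ → 0 < inner ℝ (T.orient (γ s)) (deriv γ s)) ∨
    (∀ᵐ s : ℝ, s ∈ Ioo (0 : ℝ) 1 → |s - t| < δ → inner ℝ (T.orient (γ s)) (deriv γ s) < 0)

end RectifiableCurrent

/-! The proof is a local surgery. The condition on the minimum enters as `c ≤ θ` along the curve.
Take a short embedded arc `Γ` of the curve along which `ξ` keeps one sign. Remove `c` units of flow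
from `Γ` and send them along the segment `L` joining its endpoints. The boundary is unchanged, so
the result is a competitor. Since `H_{c,α}(x + c) = H_{c,α}(x) + 1`, removal lowers the cost density
by exactly one on `Γ`. Addition raises it by at most one on `L`, even where the new flow meets or
cancels the old. Optimality and finiteness of the cost then give `H¹(Γ) ≤ H¹(L)`, which is
`IsOptimal.hausdorffMeasure_le_edist`.

To use this, `Γ` must carry a current with boundary at its endpoints. The area formula
`hausdorffMeasure_restrict_image_Icc` moves integrals over `Γ` to the parameter interval.
`IsUnitTangentField.ae_tangent_curve` shows that `ξ` is parallel to the velocity almost everywhere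
on `Γ`, so with the sign known `ξ` is the normalised velocity up to that sign. An arc no longer than
its chord has constant direction, by equality in Cauchy-Schwarz.

Hence the unit tangent of the curve is locally constant off the finite set of reversals. It is
continuous on the open interval, so it is constant, and the image is a segment. Working locally
avoids any assumption that the curve is injective. -/

open scoped NNReal Topology
open Filter

/-! ### Chord length bounds `H¹` of a curve from below -/

section CurveLength

variable {X : Type*} [MetricSpace X] [MeasurableSpace X] [BorelSpace X]

/-- The distance to `γ x` is 1-Lipschitz, and by the intermediate value theorem it takes every value
up to the chord length on the image. -/
theorem ofReal_dist_le_hausdorffMeasure_image {γ : ℝ → X} {x y : ℝ} (hxy : x ≤ y)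
    (hγ : ContinuousOn γ (Icc x y)) :
    ENNReal.ofReal (dist (γ x) (γ y)) ≤ Measure.hausdorffMeasure 1 (γ '' Icc x y) := by
  have h1 : Icc (0 : ℝ) (dist (γ x) (γ y)) ⊆ (fun z => dist (γ x) z) '' (γ '' Icc x y) := by
    rw [image_image]
    have := intermediate_value_Icc hxy (f := fun t => dist (γ x) (γ t))
      ((continuous_const.dist continuous_id).comp_continuousOn hγ)
    simpa using this
  have h2 : LipschitzWith 1 (fun z => dist (γ x) z) := LipschitzWith.dist_right _
  have h3 := h2.hausdorffMeasure_image_le (d := 1) zero_le_one (γ '' Icc x y)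
  rw [hausdorffMeasure_real] at h3
  calc ENNReal.ofReal (dist (γ x) (γ y)) = volume (Icc (0 : ℝ) (dist (γ x) (γ y))) := by simp
    _ ≤ _ := measure_mono h1
    _ ≤ _ := by simpa using h3

end CurveLength

/-! ### The area formula for embedded `C¹` arcs -/

section AreaFormula

/-- Speed-weighted Lebesgue measure on the parameter interval `[a, b]`. -/
noncomputable def speedMeasure {E : Type*} [Norm E] (γ' : ℝ → E) (a b : ℝ) : Measure ℝ :=
  (volume.restrict (Icc a b)).withDensity fun s => ENNReal.ofReal ‖γ' s‖

variable {E : Type*} [NormedAddCommGroup E] [NormedSpace ℝ E] [MeasurableSpace E] [BorelSpace E]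

/-- Strict differentiability compares `γ` with its linear part for all pairs of parameters near `s`:
this yields a Lipschitz constant `‖v‖ + ε` for the upper bound and a chord estimate for the lower
one. -/
theorem HasStrictDerivAt.exists_hausdorffMeasure_image_Icc_bounds {γ : ℝ → E} {v : E} {s ε : ℝ}
    (h : HasStrictDerivAt γ v s) (hε : 0 < ε) :
    ∃ δ > 0, ∀ x y, |x - s| < δ → |y - s| < δ → x ≤ y →
      Measure.hausdorffMeasure 1 (γ '' Icc x y) ≤ ENNReal.ofReal ((‖v‖ + ε) * (y - x)) ∧
      ENNReal.ofReal ((‖v‖ - ε) * (y - x)) ≤ Measure.hausdorffMeasure 1 (γ '' Icc x y) := by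
  have h1 := h.hasStrictFDerivAt.isLittleO.def hε
  obtain ⟨δ, hδ, h2⟩ := Metric.eventually_nhds_iff.1 h1
  have key : ∀ x y, |x - s| < δ → |y - s| < δ → ‖γ x - γ y - (x - y) • v‖ ≤ ε * |x - y| := by
    intro x y hx hy
    have := @h2 (x, y) (by simp [Prod.dist_eq, Real.dist_eq, hx, hy])
    simpa using this
  refine ⟨δ, hδ, fun x y hx hy hxy => ?_⟩
  have hmem : ∀ z ∈ Icc x y, |z - s| < δ := by
    intro z hz
    rw [abs_lt] at *
    constructor <;> linarith [hz.1, hz.2]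
  have hlip : LipschitzOnWith (Real.toNNReal (‖v‖ + ε)) γ (Icc x y) := by
    refine LipschitzOnWith.of_dist_le_mul fun p hp q hq => ?_
    rw [Real.coe_toNNReal _ (by positivity), dist_eq_norm, Real.dist_eq]
    have := key p q (hmem p hp) (hmem q hq)
    have h3 : ‖γ p - γ q‖ ≤ ‖γ p - γ q - (p - q) • v‖ + ‖(p - q) • v‖ := by
      simpa using norm_add_le (γ p - γ q - (p - q) • v) ((p - q) • v)
    rw [norm_smul, Real.norm_eq_abs] at h3
    linarith
  constructor
  · have := hlip.hausdorffMeasure_image_le (d := 1) zero_le_one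
    rw [hausdorffMeasure_real] at this
    refine this.trans (le_of_eq ?_)
    rw [ENNReal.rpow_one, Real.volume_Icc, ENNReal.ofReal_mul (by positivity)]
    rfl
  · refine le_trans (ENNReal.ofReal_le_ofReal ?_)
      (ofReal_dist_le_hausdorffMeasure_image hxy hlip.continuousOn)
    rw [dist_comm, dist_eq_norm]
    have := key y x hy hx
    have h3 : ‖(y - x) • v‖ ≤ ‖γ y - γ x‖ + ‖γ y - γ x - (y - x) • v‖ := by
      have := norm_sub_le (γ y - γ x) (γ y - γ x - (y - x) • v)
      simpa using this
    rw [norm_smul, Real.norm_eq_abs] at h3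
    rw [abs_of_nonneg (by linarith)] at h3 this
    linarith

variable {γ γ' : ℝ → E} {a b k : ℝ}

/-- Area formula for a `C¹` arc. -/
theorem hausdorffMeasure_restrict_image_Icc
    (hd : ∀ s ∈ Icc a b, HasStrictDerivAt γ (γ' s) s) (hc : ContinuousOn γ' (Icc a b))
    (hk : 0 < k) (hanti : ∀ x ∈ Icc a b, ∀ y ∈ Icc a b, k * |x - y| ≤ ‖γ x - γ y‖) :
    (Measure.hausdorffMeasure 1).restrict (γ '' Icc a b) = (speedMeasure γ' a b).map γ := by
  set Γ := γ '' Icc a b with hΓ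
  set ψ : E → ℝ := Function.invFunOn γ (Icc a b) with hψ
  have hγc : ContinuousOn γ (Icc a b) := fun s hs =>
    (hd s hs).hasDerivAt.continuousAt.continuousWithinAt
  have hinj : InjOn γ (Icc a b) := by
    intro x hx y hy hxy
    have := hanti x hx y hy
    rw [hxy, sub_self, norm_zero] at this
    have : |x - y| ≤ 0 := by
      by_contra hlt
      push Not at hlt
      nlinarith
    exact sub_eq_zero.1 (abs_nonpos_iff.1 this)
  have hleft : ∀ x ∈ Icc a b, ψ (γ x) = x := fun x hx => hinj.leftInvOn_invFunOn hx
  have hright : ∀ z ∈ Γ, γ (ψ z) = z := fun z hz => Function.invFunOn_eq hz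
  have hψlip : LipschitzOnWith (Real.toNNReal k⁻¹) ψ Γ := by
    refine LipschitzOnWith.of_dist_le_mul ?_
    rintro _ ⟨x, hx, rfl⟩ _ ⟨y, hy, rfl⟩
    rw [hleft x hx, hleft y hy, Real.coe_toNNReal _ (by positivity), Real.dist_eq, dist_eq_norm,
      inv_mul_eq_div, le_div_iff₀ hk, mul_comm]
    exact hanti x hx y hy
  have hΓm : MeasurableSet Γ := (isCompact_Icc.image_of_continuousOn hγc).isClosed.measurableSet
  have hψm : AEMeasurable ψ ((Measure.hausdorffMeasure 1).restrict Γ) :=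
    hψlip.continuousOn.aemeasurable hΓm
  -- The comparison is made on the parameter line, where two measures agree once they agree on
  -- half-open intervals.
  set ν : Measure ℝ := ((Measure.hausdorffMeasure 1).restrict Γ).map ψ with hν
  have hνapp : ∀ B, MeasurableSet B → ν B = Measure.hausdorffMeasure 1 (γ '' (B ∩ Icc a b)) := by
    intro B hB
    rw [hν, Measure.map_apply_of_aemeasurable hψm hB, Measure.restrict_apply₀' hΓm.nullMeasurableSet]
    congr 1
    ext z
    constructor
    · rintro ⟨h1, x, hx, rfl⟩
      refine ⟨x, ⟨?_, hx⟩, rfl⟩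
      rw [mem_preimage, hleft x hx] at h1
      exact h1
    · rintro ⟨x, hx, rfl⟩
      exact ⟨by rw [mem_preimage, hleft x hx.2]; exact hx.1, x, hx.2, rfl⟩
  have hns : NullSingletonClass (Measure.hausdorffMeasure 1 : Measure E) :=
    Measure.nullSingletonClass_hausdorff E one_pos
  have hνIcc : ∀ x y, a ≤ x → y ≤ b → ν (Ioc x y) = Measure.hausdorffMeasure 1 (γ '' Icc x y) := by
    intro x y hx hy
    rcases lt_or_ge y x with hxy | hxy
    · simp [Ioc_eq_empty_of_le hxy.le, Icc_eq_empty_of_lt hxy]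
    · rw [hνapp _ measurableSet_Ioc, inter_eq_left.2 (Ioc_subset_Icc_self.trans (Icc_subset_Icc hx hy))]
      refine le_antisymm (measure_mono (image_mono Ioc_subset_Icc_self)) ?_
      rw [← Ioc_insert_left hxy, image_insert_eq]
      exact (measure_union_le {γ x} _).trans (by simp)
  obtain ⟨C, hC⟩ := isCompact_Icc.exists_bound_of_continuousOn hc
  have hfin : ν univ ≠ ∞ := by
    rw [hνapp _ MeasurableSet.univ, univ_inter]
    have hlip : LipschitzOnWith (Real.toNNReal C) γ (Icc a b) := by
      refine (convex_Icc a b).lipschitzOnWith_of_nnnorm_hasDerivWithin_le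
        (fun s hs => (hd s hs).hasDerivAt.hasDerivWithinAt) fun s hs => ?_
      rw [← NNReal.coe_le_coe]
      exact (hC s hs).trans (Real.le_coe_toNNReal C)
    refine ((hlip.hausdorffMeasure_image_le zero_le_one).trans_lt ?_).ne
    rw [hausdorffMeasure_real, ENNReal.rpow_one, Real.volume_Icc]
    exact ENNReal.mul_lt_top ENNReal.coe_lt_top ENNReal.ofReal_lt_top
  have : IsFiniteMeasure ν := ⟨lt_top_iff_ne_top.2 hfin⟩
  -- The distribution function of `ν` has the speed as its derivative, so the fundamental theorem of
  -- calculus identifies `ν` on intervals.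
  have hG : ∀ s ∈ Icc a b,
      HasDerivWithinAt (fun y => ν.real (Ioc a y)) ‖γ' s‖ (Icc a b) s := by
    intro s hs
    rw [hasDerivWithinAt_iff_isLittleO, Asymptotics.isLittleO_iff]
    intro ε hε
    obtain ⟨δ, hδ, hb⟩ := (hd s hs).exists_hausdorffMeasure_image_Icc_bounds hε
    have hdiff : ∀ x y, a ≤ x → x ≤ y → y ≤ b → |x - s| < δ → |y - s| < δ →
        |ν.real (Ioc a y) - ν.real (Ioc a x) - (y - x) * ‖γ' s‖| ≤ ε * (y - x) := by
      intro x y hx hxy hy hxs hys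
      have h1 : ν.real (Ioc a y) = ν.real (Ioc a x) + ν.real (Ioc x y) := by
        rw [← Ioc_union_Ioc_eq_Ioc hx hxy,
          measureReal_union (Ioc_disjoint_Ioc_of_le le_rfl) measurableSet_Ioc]
      obtain ⟨h2, h3⟩ := hb x y hxs hys hxy
      rw [← hνIcc x y hx hy, ← ofReal_measureReal] at h2 h3
      rw [ENNReal.ofReal_le_ofReal_iff (mul_nonneg (by positivity) (by linarith))] at h2
      rw [ENNReal.ofReal_le_ofReal_iff measureReal_nonneg] at h3
      rw [h1, abs_le]
      constructor <;> nlinarith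
    have hev : ∀ᶠ y in 𝓝[Icc a b] s, |y - s| < δ := by
      refine nhdsWithin_le_nhds (Metric.eventually_nhds_iff.2 ⟨δ, hδ, fun y hy => ?_⟩)
      rwa [Real.dist_eq] at hy
    filter_upwards [hev, self_mem_nhdsWithin] with y hy hyI
    rw [Real.norm_eq_abs, Real.norm_eq_abs, smul_eq_mul]
    rcases le_total s y with hsy | hsy
    · rw [abs_of_nonneg (sub_nonneg.2 hsy)]
      exact hdiff s y hs.1 hsy hyI.2 (by simpa using hδ) hy
    · rw [abs_of_nonpos (sub_nonpos.2 hsy), neg_sub]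
      have := hdiff y s hyI.1 hsy hs.2 hy (by simpa using hδ)
      rw [← abs_neg] at this
      convert this using 2
      ring
  have hGint : ∀ x y, a ≤ x → x ≤ y → y ≤ b → ν (Ioc x y) = ENNReal.ofReal (∫ s in x..y, ‖γ' s‖) := by
    intro x y hx hxy hy
    have hsub : Icc x y ⊆ Icc a b := Icc_subset_Icc hx hy
    rw [intervalIntegral.integral_eq_sub_of_hasDerivAt_of_le hxy (f := fun y => ν.real (Ioc a y))
      (fun s hs => (hG s (hsub hs)).continuousWithinAt.mono hsub) (fun s hs => ?_)
      ((hc.norm.mono hsub).intervalIntegrable_of_Icc hxy)]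
    · rw [← Ioc_union_Ioc_eq_Ioc hx hxy,
        measureReal_union (Ioc_disjoint_Ioc_of_le le_rfl) measurableSet_Ioc, add_sub_cancel_left,
        ofReal_measureReal]
    · exact (hG s (hsub (Ioo_subset_Icc_self hs))).hasDerivAt
        (Icc_mem_nhds (lt_of_le_of_lt hx hs.1) (lt_of_lt_of_le hs.2 hy))
  have hsp : ∀ x y, a ≤ x → x ≤ y → y ≤ b →
      speedMeasure γ' a b (Ioc x y) = ENNReal.ofReal (∫ s in x..y, ‖γ' s‖) := by
    intro x y hx hxy hy
    have hsub : Icc x y ⊆ Icc a b := Icc_subset_Icc hx hy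
    rw [speedMeasure, withDensity_apply _ measurableSet_Ioc,
      Measure.restrict_restrict measurableSet_Ioc,
      inter_eq_left.2 (Ioc_subset_Icc_self.trans hsub), intervalIntegral.integral_of_le hxy,
      ofReal_integral_eq_lintegral_ofReal]
    · exact ((hc.norm.mono hsub).integrableOn_Icc).mono_set Ioc_subset_Icc_self
    · exact Eventually.of_forall fun _ => norm_nonneg _
  -- Both measures vanish outside `[a, b]` and at the point `a`, so any half-open interval may be
  -- clipped to `[a, b]`.
  have hcap : ∀ x y, ν (Ioc x y) = ν (Ioc (max x a) (min y b)) ∧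
      speedMeasure γ' a b (Ioc x y) = speedMeasure γ' a b (Ioc (max x a) (min y b)) := by
    intro x y
    have h0 : speedMeasure γ' a b {a} = 0 := by
      rw [speedMeasure, withDensity_apply _ (measurableSet_singleton a)]
      refine setLIntegral_measure_zero _ _ ?_
      exact le_antisymm ((Measure.restrict_apply_le _ _).trans (by simp)) zero_le
    have h0' : ν {a} = 0 := by
      rw [hνapp _ (measurableSet_singleton a)]
      refine le_antisymm ((measure_mono (image_mono inter_subset_left)).trans ?_) zero_le
      simp
    have h1 : speedMeasure γ' a b (Icc a b)ᶜ = 0 := by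
      rw [speedMeasure, withDensity_apply _ measurableSet_Icc.compl]
      refine setLIntegral_measure_zero _ _ ?_
      simp [Measure.restrict_apply measurableSet_Icc.compl]
    have h1' : ν (Icc a b)ᶜ = 0 := by
      rw [hνapp _ measurableSet_Icc.compl]
      simp
    have hs1 : Ioc x y ⊆ Ioc (max x a) (min y b) ∪ ({a} ∪ (Icc a b)ᶜ) := by
      intro z hz
      by_cases hzI : z ∈ Icc a b
      · rcases hzI.1.eq_or_lt with h | h
        · right; left; exact h.symm
        · left; exact ⟨max_lt hz.1 h, le_min hz.2 hzI.2⟩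
      · right; right; exact hzI
    have hs2 : Ioc (max x a) (min y b) ⊆ Ioc x y :=
      Ioc_subset_Ioc (le_max_left _ _) (min_le_left _ _)
    constructor
    · refine le_antisymm ((measure_mono hs1).trans ((measure_union_le _ _).trans ?_))
        (measure_mono hs2)
      rw [measure_union_null h0' h1', add_zero]
    · refine le_antisymm ((measure_mono hs1).trans ((measure_union_le _ _).trans ?_))
        (measure_mono hs2)
      rw [measure_union_null h0 h1, add_zero]
  have hνsp : ν = speedMeasure γ' a b := by
    refine Measure.ext_of_Ioc _ _ fun x y _ => ?_
    rw [(hcap x y).1, (hcap x y).2]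
    rcases lt_or_ge (min y b) (max x a) with h | h
    · rw [Ioc_eq_empty_of_le h.le, measure_empty, measure_empty]
    · rw [hGint _ _ (le_max_right _ _) h (min_le_right _ _),
        hsp _ _ (le_max_right _ _) h (min_le_right _ _)]
  have hac : speedMeasure γ' a b ≪ volume.restrict (Icc a b) := withDensity_absolutelyContinuous _ _
  have hγm : AEMeasurable γ ν := by
    rw [hνsp]
    exact (hγc.aemeasurable measurableSet_Icc).mono_ac hac
  rw [← hνsp, hν, AEMeasurable.map_map_of_aemeasurable (by rwa [← hν]) hψm]
  conv_lhs => rw [← Measure.map_id (μ := (Measure.hausdorffMeasure 1).restrict Γ)]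
  refine Measure.map_congr ?_
  filter_upwards [ae_restrict_mem hΓm] with z hz
  exact (hright z hz).symm

end AreaFormula

/-! ### Tangency of the orientation to an arbitrary curve in the carrier -/

section Tangent

variable {E : Type*} [NormedAddCommGroup E] [NormedSpace ℝ E]

/-- At a transversal meeting the map `(s, t) ↦ f s - g t` has an injective derivative, so the
parameter pair is isolated among its zeros. A discrete subset of the plane is countable. -/
theorem countable_transversal_intersections {f g f' g' : ℝ → E} {S T : Set ℝ}
    (hf : ∀ s ∈ S, HasDerivAt f (f' s) s) (hg : ∀ t ∈ T, HasDerivAt g (g' t) t) :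
    {x | ∃ s ∈ S, ∃ t ∈ T, f s = x ∧ g t = x ∧ LinearIndependent ℝ ![f' s, g' t]}.Countable := by
  set D : Set (ℝ × ℝ) :=
    {z | z.1 ∈ S ∧ z.2 ∈ T ∧ f z.1 = g z.2 ∧ LinearIndependent ℝ ![f' z.1, g' z.2]} with hD
  have hdisc : DiscreteTopology D := by
    rw [discreteTopology_subtype_iff]
    rintro ⟨s, t⟩ ⟨hs, ht, hst, hli⟩
    have h1 : HasFDerivAt (fun z : ℝ × ℝ => f z.1 - g z.2)
        (((ContinuousLinearMap.toSpanSingleton ℝ (f' s)).comp (ContinuousLinearMap.fst ℝ ℝ ℝ)) -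
          (ContinuousLinearMap.toSpanSingleton ℝ (g' t)).comp (ContinuousLinearMap.snd ℝ ℝ ℝ))
        (s, t) :=
      (HasFDerivAt.comp (s, t) (hf s hs).hasFDerivAt hasFDerivAt_fst).sub
        (HasFDerivAt.comp (s, t) (hg t ht).hasFDerivAt hasFDerivAt_snd)
    have h2 := h1.eventually_ne (c := 0) ?_
    · rw [← le_bot_iff, ← principal_empty, le_principal_iff, mem_inf_principal]
      filter_upwards [h2] with z hz hzD
      exact hz (sub_eq_zero.2 hzD.2.2.1)
    · set A : ℝ × ℝ →L[ℝ] E :=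
        (ContinuousLinearMap.toSpanSingleton ℝ (f' s)).comp (ContinuousLinearMap.fst ℝ ℝ ℝ) -
          (ContinuousLinearMap.toSpanSingleton ℝ (g' t)).comp (ContinuousLinearMap.snd ℝ ℝ ℝ)
        with hA
      have hker : (A : ℝ × ℝ →ₗ[ℝ] E).ker = ⊥ := by
        rw [LinearMap.ker_eq_bot']
        rintro ⟨σ, τ⟩ h
        have h3 : σ • f' s + (-τ) • g' t = 0 := by
          rw [neg_smul, ← sub_eq_add_neg]
          simpa [hA] using h
        obtain ⟨h4, h5⟩ := LinearIndependent.pair_iff.1 hli _ _ h3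
        simp [h4, neg_eq_zero.1 h5]
      obtain ⟨K, -, hK⟩ := LinearMap.exists_antilipschitzWith (A : ℝ × ℝ →ₗ[ℝ] E) hker
      exact ⟨K, hK⟩
  have hcount : D.Countable := by
    rw [← Set.countable_coe_iff]
    exact countable_of_Lindelof_of_discrete
  refine (hcount.image fun z => f z.1).mono ?_
  rintro x ⟨s, hs, t, ht, rfl, h, hli⟩
  exact ⟨(s, t), ⟨hs, ht, h.symm, hli⟩, rfl⟩

end Tangent

section UnitTangent

variable {m : ℕ} {M : Set (EuclideanSpace ℝ (Fin m))}
  {ξ : EuclideanSpace ℝ (Fin m) → EuclideanSpace ℝ (Fin m)}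

/-- The orientation is tangent to the covering curves. These cross `γ` transversally at only
countably many points, an `H¹`-null set, so elsewhere on `M` the velocity of `γ` is parallel to that
of the covering curve. -/
theorem IsUnitTangentField.ae_tangent_curve (h : IsUnitTangentField M ξ)
    {γ γ' : ℝ → EuclideanSpace ℝ (Fin m)} {S : Set ℝ} (hγ : ∀ s ∈ S, HasDerivAt γ (γ' s) s)
    (hγ' : ∀ s ∈ S, γ' s ≠ 0) :
    ∀ᵐ x ∂((Measure.hausdorffMeasure 1).restrict M),
      ‖ξ x‖ = 1 ∧ ∀ s ∈ S, γ s = x → ∃ r : ℝ, ξ x = r • γ' s := by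
  obtain ⟨f, hf, hae⟩ := h
  have : NullSingletonClass (Measure.hausdorffMeasure 1 : Measure (EuclideanSpace ℝ (Fin m))) :=
    Measure.nullSingletonClass_hausdorff _ one_pos
  have hnull := fun i => (countable_transversal_intersections (T := univ) hγ
    (fun t _ => ((hf i).1.differentiable one_ne_zero t).hasDerivAt)).ae_notMem
      ((Measure.hausdorffMeasure 1).restrict M)
  filter_upwards [hae, ae_all_iff.2 hnull] with x ⟨h1, i, t, hit, hspan⟩ h2
  refine ⟨h1, fun s hs hsx => ?_⟩
  have h3 : ¬ LinearIndependent ℝ ![γ' s, deriv (f i) t] := fun hli =>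
    h2 i ⟨s, hs, t, mem_univ _, hsx, hit, hli⟩
  rw [LinearIndependent.pair_iff' (hγ' s hs)] at h3
  push Not at h3
  obtain ⟨r, hr⟩ := h3
  obtain ⟨k, hk⟩ := Submodule.mem_span_singleton.1 hspan
  exact ⟨k * r, by rw [← hk, ← hr, smul_smul]⟩

end UnitTangent

/-! ### Boundary of the current carried by an arc -/

section ArcIntegral

variable {E : Type*} [NormedAddCommGroup E] {γ γ' : ℝ → E} {a b k : ℝ}

theorem aemeasurable_speedMeasure [MeasurableSpace E] [BorelSpace E]
    (hγ : ContinuousOn γ (Icc a b)) :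
    AEMeasurable γ (speedMeasure γ' a b) :=
  (hγ.aemeasurable measurableSet_Icc).mono_ac (withDensity_absolutelyContinuous _ _)

theorem aemeasurable_ofReal_speed (hc : ContinuousOn γ' (Icc a b)) :
    AEMeasurable (fun s => ENNReal.ofReal ‖γ' s‖) (volume.restrict (Icc a b)) :=
  (hc.norm.aemeasurable measurableSet_Icc).ennreal_ofReal

theorem ae_speedMeasure_iff (hc : ContinuousOn γ' (Icc a b)) (h0 : ∀ s ∈ Icc a b, γ' s ≠ 0)
    {p : ℝ → Prop} :
    (∀ᵐ s ∂speedMeasure γ' a b, p s) ↔ ∀ᵐ s ∂volume.restrict (Icc a b), p s := by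
  rw [speedMeasure, ae_withDensity_iff' (aemeasurable_ofReal_speed hc)]
  refine eventually_congr ?_
  filter_upwards [ae_restrict_mem measurableSet_Icc] with s hs
  simp [h0 s hs]

variable [NormedSpace ℝ E] [MeasurableSpace E] [BorelSpace E]

/-- After the area formula the speed factor turns `ξ` into `ε • γ'`, and the integrand becomes `ε`
times the derivative of `f ∘ γ`. -/
theorem setIntegral_image_fderiv [SecondCountableTopology E]
    (hd : ∀ s ∈ Icc a b, HasStrictDerivAt γ (γ' s) s) (hc : ContinuousOn γ' (Icc a b))
    (hab : a ≤ b) (hk : 0 < k)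
    (hanti : ∀ x ∈ Icc a b, ∀ y ∈ Icc a b, k * |x - y| ≤ ‖γ x - γ y‖)
    {ξ : E → E} {ε : ℝ}
    (hξm : AEStronglyMeasurable ξ ((Measure.hausdorffMeasure 1).restrict (γ '' Icc a b)))
    (hξ : ∀ᵐ s ∂volume.restrict (Icc a b), ‖γ' s‖ • ξ (γ s) = ε • γ' s)
    {f : E → ℝ} (hf : ContDiff ℝ 1 f) :
    ∫ x in γ '' Icc a b, fderiv ℝ f x (ξ x) ∂(Measure.hausdorffMeasure 1) =
      ε * (f (γ b) - f (γ a)) := by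
  have hγc : ContinuousOn γ (Icc a b) := fun s hs =>
    (hd s hs).hasDerivAt.continuousAt.continuousWithinAt
  have harea := hausdorffMeasure_restrict_image_Icc hd hc hk hanti
  have hfc : Continuous (fderiv ℝ f) := hf.continuous_fderiv one_ne_zero
  have hgm : AEStronglyMeasurable (fun x => fderiv ℝ f x (ξ x))
      ((Measure.hausdorffMeasure 1).restrict (γ '' Icc a b)) :=
    (isBoundedBilinearMap_apply (𝕜 := ℝ) (E := E) (F := ℝ)).continuous.comp_aestronglyMeasurable
      (hfc.aestronglyMeasurable.prodMk hξm)
  rw [harea] at hgm ⊢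
  rw [integral_map (aemeasurable_speedMeasure hγc) hgm, speedMeasure,
    integral_withDensity_eq_integral_toReal_smul₀ (aemeasurable_ofReal_speed hc)
      (Eventually.of_forall fun _ => ENNReal.ofReal_lt_top)]
  have h1 : ∀ᵐ s ∂volume.restrict (Icc a b),
      (ENNReal.ofReal ‖γ' s‖).toReal • fderiv ℝ f (γ s) (ξ (γ s)) =
        ε * fderiv ℝ f (γ s) (γ' s) := by
    filter_upwards [hξ] with s hs
    rw [ENNReal.toReal_ofReal (norm_nonneg _), ← map_smul, hs, map_smul, smul_eq_mul]
  rw [integral_congr_ae h1, integral_const_mul, integral_Icc_eq_integral_Ioc,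
    ← intervalIntegral.integral_of_le hab]
  congr 1
  refine intervalIntegral.integral_eq_sub_of_hasDerivAt_of_le hab (f := fun s => f (γ s))
    (hf.continuous.comp_continuousOn hγc) (fun s hs => ?_) ?_
  · exact ((hf.differentiable one_ne_zero (γ s)).hasFDerivAt).comp_hasDerivAt s
      (hd s (Ioo_subset_Icc_self hs)).hasDerivAt
  · exact ContinuousOn.intervalIntegrable_of_Icc hab
      ((hfc.comp_continuousOn hγc).clm_apply hc)

end ArcIntegral

/-! ### How the cost density reacts to a change of flow by `c` -/

section CapacityCost

variable {α c x : ℝ}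

theorem capacityCost_add_self (hc : 0 < c) : capacityCost α c (x + c) = capacityCost α c x + 1 := by
  have h : (x + c) / c = x / c + 1 := by field_simp
  rw [capacityCost, capacityCost, h, Int.floor_add_one, Int.fract_add_one]
  push_cast
  ring

@[simp]
theorem capacityCost_zero : capacityCost α c 0 = 0 := by
  simp [capacityCost]

theorem capacityCost_self (hc : 0 < c) : capacityCost α c c = 1 := by
  simpa using capacityCost_add_self (α := α) (x := 0) hc

theorem capacityCost_nonneg (hc : 0 < c) (hx : 0 ≤ x) : 0 ≤ capacityCost α c x := by
  rw [capacityCost]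
  have h1 : (0 : ℝ) ≤ ⌊x / c⌋ := by exact_mod_cast Int.floor_nonneg.2 (by positivity)
  split_ifs
  · simpa using h1
  · exact add_nonneg h1 (Real.rpow_nonneg (Int.fract_nonneg _) _)

theorem one_le_capacityCost (hc : 0 < c) (hx : c ≤ x) : 1 ≤ capacityCost α c x := by
  have h := capacityCost_add_self (α := α) (x := x - c) hc
  have h' := capacityCost_nonneg (α := α) hc (sub_nonneg.2 hx)
  rw [sub_add_cancel] at h
  linarith

theorem capacityCost_le_one (hα : 0 ≤ α) (hc : 0 < c) (hx : 0 ≤ x) (hxc : x ≤ c) :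
    capacityCost α c x ≤ 1 := by
  rcases hxc.eq_or_lt with rfl | h
  · exact (capacityCost_self hc).le
  · have h1 : ⌊x / c⌋ = 0 := Int.floor_eq_zero_iff.2 ⟨by positivity, (div_lt_one hc).2 h⟩
    rw [capacityCost, h1]
    split_ifs
    · simp
    · simpa using Real.rpow_le_one (Int.fract_nonneg (x / c)) (Int.fract_lt_one _).le hα

/-- This covers new flow opposing the old. If `c ≤ x`, cancellation saves one unit of cost;
otherwise the reversed remainder is at most `c` and costs at most one. -/
theorem capacityCost_abs_sub_self_le (hα : 0 ≤ α) (hc : 0 < c) (hx : 0 ≤ x) :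
    capacityCost α c |x - c| ≤ capacityCost α c x + 1 := by
  rcases le_total c x with h | h
  · have h1 := capacityCost_add_self (α := α) (x := x - c) hc
    rw [sub_add_cancel] at h1
    rw [abs_of_nonneg (sub_nonneg.2 h)]
    linarith
  · rw [abs_of_nonpos (sub_nonpos.2 h)]
    have h1 := capacityCost_nonneg (α := α) hc hx
    have h2 := capacityCost_le_one (x := -(x - c)) hα hc (by linarith) (by linarith)
    linarith

theorem capacityCost_norm_smul_add_le {E : Type*} [NormedAddCommGroup E] [NormedSpace ℝ E]
    (hα : 0 ≤ α) (hc : 0 < c) (hx : 0 ≤ x) {u w : E} (hu : ‖u‖ = 1) (hw : ‖w‖ = 1) {r : ℝ}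
    (huw : u = r • w) : capacityCost α c ‖x • u + c • w‖ ≤ capacityCost α c x + 1 := by
  have hr : |r| = 1 := by rw [huw, norm_smul, hw, mul_one] at hu; simpa using hu
  rw [huw, smul_smul, ← add_smul, norm_smul, hw, mul_one, Real.norm_eq_abs]
  rcases eq_or_eq_neg_of_abs_eq hr with rfl | rfl
  · rw [mul_one, abs_of_nonneg (by positivity), capacityCost_add_self hc]
  · have h : |x * -1 + c| = |x - c| := by rw [← abs_neg]; congr 1; ring
    rw [h]
    exact capacityCost_abs_sub_self_le hα hc hx

end CapacityCost

/-! ### Local integrability of vector fields against `H¹` -/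

section LocallyIntegrable

variable {X F : Type*} [TopologicalSpace X] [MeasurableSpace X]
  [NormedAddCommGroup F] {μ : Measure X}

theorem MeasureTheory.LocallyIntegrable.indicator_of_restrict {s : Set X} {f : X → F}
    (hs : MeasurableSet s) (hf : LocallyIntegrable f (μ.restrict s)) :
    LocallyIntegrable (s.indicator f) μ := by
  intro x
  obtain ⟨U, hU, h⟩ := hf x
  refine ⟨U, hU, ?_⟩
  rw [IntegrableOn, integrable_indicator_iff hs, IntegrableOn, Measure.restrict_comm hs]
  exact h

theorem MeasureTheory.LocallyIntegrable.norm_locallyIntegrable {f : X → F}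
    (hf : LocallyIntegrable f μ) : LocallyIntegrable (fun x => ‖f x‖) μ := fun x =>
  let ⟨U, hU, h⟩ := hf x
  ⟨U, hU, h.norm⟩

/-- This makes the three parts of the competitor separately integrable against a test form, so that
its boundary can be computed by linearity. -/
theorem MeasureTheory.LocallyIntegrable.integrable_clm_apply [OpensMeasurableSpace X] [T2Space X]
    [SecondCountableTopology X] [NormedSpace ℝ F] {G : X → F}
    (hG : LocallyIntegrable G μ) {φ : X → F →L[ℝ] ℝ} (hφ : Continuous φ)
    (hφs : HasCompactSupport φ) : Integrable (fun x => φ x (G x)) μ := by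
  have h1 : Integrable (fun x => ‖φ x‖ • ‖G x‖) μ :=
    LocallyIntegrable.integrable_smul_left_of_hasCompactSupport hG.norm_locallyIntegrable hφ.norm hφs.norm
  refine h1.mono' ?_ (Eventually.of_forall fun x => (φ x).le_opNorm (G x))
  exact (isBoundedBilinearMap_apply (𝕜 := ℝ) (E := F) (F := ℝ)).continuous.comp_aestronglyMeasurable
    (hφ.aestronglyMeasurable.prodMk hG.aestronglyMeasurable)

end LocallyIntegrable

/-! ### The unit flow along a segment -/

section Segment

variable {E : Type*} [NormedAddCommGroup E] [NormedSpace ℝ E] [MeasurableSpace E] [BorelSpace E]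
  [SecondCountableTopology E]

theorem setIntegral_segment_fderiv {p q : E} (hpq : p ≠ q) {f : E → ℝ} (hf : ContDiff ℝ 1 f) :
    ∫ x in segment ℝ p q, fderiv ℝ f x (‖q - p‖⁻¹ • (q - p)) ∂(Measure.hausdorffMeasure 1) =
      f q - f p := by
  have hne : ‖q - p‖ ≠ 0 := norm_ne_zero_iff.2 (sub_ne_zero.2 hpq.symm)
  have h := setIntegral_image_fderiv (γ := fun t : ℝ => p + t • (q - p)) (γ' := fun _ => q - p)
    (a := 0) (b := 1) (k := ‖q - p‖) (ξ := fun _ => ‖q - p‖⁻¹ • (q - p)) (ε := 1)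
    (fun s _ => ?_) continuousOn_const zero_le_one (by positivity) (fun x _ y _ => ?_)
    aestronglyMeasurable_const ?_ hf
  · rw [segment_eq_image', h]
    simp
  · simpa using ((hasStrictDerivAt_id s).smul_const (q - p)).const_add p
  · rw [add_sub_add_left_eq_sub, ← sub_smul, norm_smul, Real.norm_eq_abs, mul_comm]
  · refine Eventually.of_forall fun s => ?_
    rw [smul_smul, mul_inv_cancel₀ hne]

end Segment

/-! ### The competitor and the length inequality -/

namespace RectifiableCurrent

variable {m : ℕ} {α c : ℝ} {μm μp : Measure (EuclideanSpace ℝ (Fin m))}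

/-- The current `V H¹` carried by a locally integrable vector field `V` whose nonzero set is
tangentially covered by `C¹` curves. -/
noncomputable def ofVectorField (V : EuclideanSpace ℝ (Fin m) → EuclideanSpace ℝ (Fin m))
    (hVm : Measurable V) (hV : LocallyIntegrable V (Measure.hausdorffMeasure 1))
    (hVt : IsUnitTangentField {x | V x ≠ 0} fun x => ‖V x‖⁻¹ • V x) : RectifiableCurrent m where
  carrier := {x | V x ≠ 0}
  density x := ‖V x‖
  orient x := ‖V x‖⁻¹ • V x
  nullMeasurableSet_carrier := (hVm (measurableSet_singleton 0).compl).nullMeasurableSet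
  density_nonneg _ _ := norm_nonneg _
  locallyIntegrable_density := hV.norm_locallyIntegrable.mono_measure Measure.restrict_le_self
  aestronglyMeasurable_orient := (hVm.norm.inv.smul hVm).aestronglyMeasurable
  isUnitTangentField := hVt

theorem boundary_ofVectorField {V : EuclideanSpace ℝ (Fin m) → EuclideanSpace ℝ (Fin m)}
    (hVm : Measurable V) (hV : LocallyIntegrable V (Measure.hausdorffMeasure 1))
    (hVt : IsUnitTangentField {x | V x ≠ 0} fun x => ‖V x‖⁻¹ • V x)
    (f : EuclideanSpace ℝ (Fin m) → ℝ) :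
    (ofVectorField V hVm hV hVt).boundary f =
      ∫ x, fderiv ℝ f x (V x) ∂(Measure.hausdorffMeasure 1) := by
  have h : ∀ x, ‖V x‖ * fderiv ℝ f x (‖V x‖⁻¹ • V x) = fderiv ℝ f x (V x) := by
    intro x
    by_cases hx : V x = 0
    · simp [hx]
    · rw [map_smul, smul_eq_mul, mul_inv_cancel_left₀ (norm_ne_zero_iff.2 hx)]
  simp only [boundary, eval, ofVectorField, h]
  refine setIntegral_eq_integral_of_forall_compl_eq_zero fun x hx => ?_
  have hx' : V x = 0 := by simpa using hx
  simp [hx']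

/-- Replacing `c` units of flow along `Γ` by `c` units of flow along a segment with the same
boundary does not improve an optimal current. -/
theorem IsOptimal.hausdorffMeasure_le_edist (hα : 0 ≤ α) (hc : 0 < c) {T : RectifiableCurrent m}
    (hT : T.IsOptimal α c μm μp) (hfin : T.cost α c ≠ ∞)
    {Γ : Set (EuclideanSpace ℝ (Fin m))} (hΓm : MeasurableSet Γ) (hΓM : Γ ⊆ T.carrier)
    (hθ : ∀ x ∈ Γ, c ≤ T.density x) {p q : EuclideanSpace ℝ (Fin m)} (hpq : p ≠ q)
    (hbd : ∀ f : EuclideanSpace ℝ (Fin m) → ℝ, ContDiff ℝ 1 f →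
      ∫ x in Γ, fderiv ℝ f x (T.orient x) ∂(Measure.hausdorffMeasure 1) = f q - f p) :
    Measure.hausdorffMeasure 1 Γ ≤ edist p q := by
  set H : Measure (EuclideanSpace ℝ (Fin m)) := Measure.hausdorffMeasure 1 with hH
  -- The carrier is only null-measurable. A Borel subset of full measure permits honest indicators,
  -- at the price that `Γ` lies in it only almost everywhere.
  obtain ⟨M, hMsub, hMm, hMae⟩ := T.nullMeasurableSet_carrier.exists_measurable_subset_ae_eq
  have hMr : H.restrict M = H.restrict T.carrier := Measure.restrict_congr_set hMae
  have hθint : LocallyIntegrable T.density (H.restrict M) := by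
    rw [hMr]; exact T.locallyIntegrable_density
  have hξm : AEStronglyMeasurable T.orient (H.restrict M) := by
    rw [hMr]; exact T.aestronglyMeasurable_orient
  have hKpos : ENNReal.ofReal (c ^ α) ≠ 0 := by
    simpa using Real.rpow_pos_of_pos hc α
  -- the total cost integral is finite and dominates the length of `Γ`
  set I : ℝ≥0∞ := ∫⁻ x in M, ENNReal.ofReal (capacityCost α c (T.density x)) ∂H with hI
  have hcostT : T.cost α c = ENNReal.ofReal (c ^ α) * I := by
    rw [RectifiableCurrent.cost, hI, hMr]
  have hIfin : I ≠ ∞ := by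
    intro h
    rw [hcostT, h, ENNReal.mul_top hKpos] at hfin
    exact hfin rfl
  have hΓae : ∀ᵐ x ∂H, x ∈ Γ → x ∈ M := by
    filter_upwards [hMae] with x hx hxΓ
    exact (iff_of_eq hx).2 (hΓM hxΓ)
  have hΓfin : H Γ ≠ ∞ := by
    refine ne_top_of_le_ne_top hIfin ?_
    calc H Γ ≤ H (Γ ∩ M) := measure_mono_ae (by
          filter_upwards [hΓae] with x hx hxΓ
          exact ⟨hxΓ, hx hxΓ⟩)
      _ = ∫⁻ x in Γ ∩ M, 1 ∂H := by simp
      _ ≤ ∫⁻ x in Γ ∩ M, ENNReal.ofReal (capacityCost α c (T.density x)) ∂H := by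
          refine setLIntegral_mono' (hΓm.inter hMm) fun x hx => ?_
          rw [ENNReal.one_le_ofReal]
          exact one_le_capacityCost hc (hθ x hx.1)
      _ ≤ I := lintegral_mono_set inter_subset_right
  -- the segment
  set L : Set (EuclideanSpace ℝ (Fin m)) := segment ℝ p q with hL
  have hLm : MeasurableSet L := by
    rw [hL, segment_eq_image']
    exact (isCompact_Icc.image (by fun_prop)).isClosed.measurableSet
  have hLlen : H L = edist p q := hausdorffMeasure_segment p q
  have hLfin : H L ≠ ∞ := by rw [hLlen]; exact edist_ne_top p q
  have hqp : q - p ≠ 0 := sub_ne_zero.2 hpq.symm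
  set w : EuclideanSpace ℝ (Fin m) := ‖q - p‖⁻¹ • (q - p) with hw
  have hw1 : ‖w‖ = 1 := norm_smul_inv_norm hqp
  -- properties of `T` almost everywhere
  obtain ⟨f, hf, hfae⟩ := T.isUnitTangentField
  have hline : ∀ s : ℝ, HasDerivAt (fun t : ℝ => p + t • (q - p)) (q - p) s := fun s => by
    simpa using ((hasDerivAt_id s).smul_const (q - p)).const_add p
  -- Where the segment overlaps the carrier, old and new flow must be parallel for their sum to
  -- remain tangential.
  have hLae := T.isUnitTangentField.ae_tangent_curve (S := univ) (γ := fun t : ℝ => p + t • (q - p))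
    (γ' := fun _ => q - p) (fun s _ => hline s) (fun _ _ => hqp)
  rw [← hH, ← hMr] at hLae hfae
  set θ₀ := hθint.aestronglyMeasurable.mk T.density with hθ₀
  set ξ₀ := hξm.mk T.orient with hξ₀
  have hθ₀m : Measurable θ₀ := hθint.aestronglyMeasurable.stronglyMeasurable_mk.measurable
  have hξ₀m : Measurable ξ₀ := hξm.stronglyMeasurable_mk.measurable
  have hM1 : ∀ᵐ x ∂H.restrict M, θ₀ x = T.density x ∧ ξ₀ x = T.orient x ∧ ‖ξ₀ x‖ = 1 ∧
      (∃ i t, f i t = x ∧ ξ₀ x ∈ Submodule.span ℝ {deriv (f i) t}) ∧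
      (x ∈ L → ∃ r : ℝ, ξ₀ x = r • w) := by
    filter_upwards [hθint.aestronglyMeasurable.ae_eq_mk, hξm.ae_eq_mk, hLae, hfae]
      with x h1 h2 h3 h4
    rw [← hθ₀] at h1
    rw [← hξ₀] at h2
    rw [← h1, ← h2]
    refine ⟨rfl, rfl, h3.1, h4.2, fun hxL => ?_⟩
    rw [hL, segment_eq_image'] at hxL
    obtain ⟨t, -, ht⟩ := hxL
    obtain ⟨r, hr⟩ := h3.2 t (mem_univ _) ht
    refine ⟨r * ‖q - p‖, ?_⟩
    rw [hr, hw, smul_smul, mul_assoc, mul_inv_cancel₀ (norm_ne_zero_iff.2 hqp), mul_one]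
  have hM2 := (ae_restrict_iff' hMm).1 hM1
  -- the competitor
  set G₁ : EuclideanSpace ℝ (Fin m) → EuclideanSpace ℝ (Fin m) :=
    M.indicator fun x => θ₀ x • ξ₀ x with hG₁
  set G₂ : EuclideanSpace ℝ (Fin m) → EuclideanSpace ℝ (Fin m) :=
    Γ.indicator fun x => c • ξ₀ x with hG₂
  set G₃ : EuclideanSpace ℝ (Fin m) → EuclideanSpace ℝ (Fin m) :=
    L.indicator fun _ => c • w with hG₃
  have hG₁m : Measurable G₁ := (hθ₀m.smul hξ₀m).indicator hMm
  have hG₂m : Measurable G₂ := (hξ₀m.const_smul c).indicator hΓm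
  have hG₃m : Measurable G₃ := measurable_const.indicator hLm
  have hG₁i : LocallyIntegrable G₁ H := by
    refine LocallyIntegrable.indicator_of_restrict hMm
      (hθint.mono (hθ₀m.smul hξ₀m).aestronglyMeasurable ?_)
    filter_upwards [hM1] with x hx
    rw [norm_smul, hx.2.2.1, hx.1, mul_one]
  have hG₂i : LocallyIntegrable G₂ H := by
    refine Integrable.locallyIntegrable ?_
    refine Integrable.mono' (g := Γ.indicator fun _ => c)
      ((integrable_indicator_iff hΓm).2 (integrableOn_const hΓfin)) hG₂m.aestronglyMeasurable ?_
    filter_upwards [hM2, hΓae] with x hx hxΓ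
    by_cases h : x ∈ Γ
    · simp [hG₂, h, norm_smul, (hx (hxΓ h)).2.2.1, abs_of_pos hc]
    · simp [hG₂, h]
  have hG₃i : LocallyIntegrable G₃ H :=
    ((integrable_indicator_iff hLm).2 (integrableOn_const hLfin)).locallyIntegrable
  set V : EuclideanSpace ℝ (Fin m) → EuclideanSpace ℝ (Fin m) := G₁ - G₂ + G₃ with hV
  have hVm : Measurable V := (hG₁m.sub hG₂m).add hG₃m
  have hVi : LocallyIntegrable V H := (hG₁i.sub hG₂i).add hG₃i
  -- The density left after removal; it is nonnegative on the carrier because `c ≤ θ` on `Γ`.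
  set a : EuclideanSpace ℝ (Fin m) → ℝ := fun x => T.density x - Γ.indicator (fun _ => c) x with ha
  have hVM : ∀ᵐ x ∂H, (x ∈ M → V x = a x • ξ₀ x + L.indicator (fun _ => c • w) x) ∧
      (x ∉ M → V x = L.indicator (fun _ => c • w) x) := by
    filter_upwards [hM2, hΓae] with x hx hxΓ
    constructor
    · intro h
      by_cases h' : x ∈ Γ
      · simp [hV, hG₁, hG₂, hG₃, h, h', ha, (hx h).1, sub_smul]
      · simp [hV, hG₁, hG₂, hG₃, h, h', ha, (hx h).1]
    · intro h
      have h' : x ∉ Γ := fun h' => h (hxΓ h')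
      simp [hV, hG₁, hG₂, hG₃, h, h']
  have hVt : IsUnitTangentField {x | V x ≠ 0} fun x => ‖V x‖⁻¹ • V x := by
    -- Index `0` is the full line through `p` and `q`; the cover of `T` is shifted by one. The line
    -- serves points of `L`, the old cover all others.
    refine ⟨fun n => Nat.casesOn n (fun t : ℝ => p + t • (q - p)) f, ?_, ?_⟩
    · rintro (_ | n)
      · refine ⟨by simp only; fun_prop, fun t => ?_⟩
        change deriv (fun t : ℝ => p + t • (q - p)) t ≠ 0
        rw [(hline t).deriv]
        exact hqp
      · exact hf n
    · have hV0 : MeasurableSet {x | V x ≠ 0} := hVm (measurableSet_singleton 0).compl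
      rw [ae_restrict_iff' hV0]
      filter_upwards [hM2, hVM] with x hx hxV hx0
      have hx0' : V x ≠ 0 := hx0
      refine ⟨norm_smul_inv_norm hx0', ?_⟩
      by_cases hxL : x ∈ L
      · have hxL' := hxL
        rw [hL, segment_eq_image'] at hxL'
        obtain ⟨t, -, ht⟩ := hxL'
        refine ⟨0, t, ht, Submodule.smul_mem _ _ ?_⟩
        have hwm : w ∈ Submodule.span ℝ {deriv (fun t : ℝ => p + t • (q - p)) t} := by
          rw [(hline t).deriv]
          exact Submodule.smul_mem _ _ (Submodule.mem_span_singleton_self _)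
        by_cases hxM : x ∈ M
        · obtain ⟨r, hr⟩ := (hx hxM).2.2.2.2 hxL
          rw [hxV.1 hxM, hr, indicator_of_mem hxL]
          exact Submodule.add_mem _ (Submodule.smul_mem _ _ (Submodule.smul_mem _ _ hwm))
            (Submodule.smul_mem _ _ hwm)
        · rw [hxV.2 hxM, indicator_of_mem hxL]
          exact Submodule.smul_mem _ _ hwm
      · have hxM : x ∈ M := by
          by_contra h
          rw [hxV.2 h, indicator_of_notMem hxL] at hx0'
          exact hx0' rfl
        obtain ⟨i, t, hit, hsp⟩ := (hx hxM).2.2.2.1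
        refine ⟨i + 1, t, hit, Submodule.smul_mem _ _ ?_⟩
        rw [hxV.1 hxM, indicator_of_notMem hxL, add_zero]
        exact Submodule.smul_mem _ _ hsp
  set S := ofVectorField V hVm hVi hVt with hS
  have hSpath : S.IsTransportPath μm μp := by
    intro g hg hgs
    have hg1 : ContDiff ℝ 1 g := hg.of_le (by exact_mod_cast le_top)
    rw [← hT.1 g hg hgs, hS, boundary_ofVectorField]
    have hφ : Continuous (fderiv ℝ g) := hg1.continuous_fderiv one_ne_zero
    have hφs : HasCompactSupport (fderiv ℝ g) := hgs.fderiv (𝕜 := ℝ)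
    have i₁ := hG₁i.integrable_clm_apply hφ hφs
    have i₂ := hG₂i.integrable_clm_apply hφ hφs
    have i₃ := hG₃i.integrable_clm_apply hφ hφs
    have e₁ : ∫ x, fderiv ℝ g x (G₁ x) ∂H = T.boundary g := by
      have : ∀ x, fderiv ℝ g x (G₁ x) = M.indicator (fun x => θ₀ x * fderiv ℝ g x (ξ₀ x)) x := by
        intro x
        by_cases h : x ∈ M <;> simp [hG₁, h]
      simp_rw [this]
      rw [integral_indicator hMm, boundary, eval, ← hH, ← hMr]
      refine integral_congr_ae ?_
      filter_upwards [hM1] with x hx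
      rw [hx.1, hx.2.1]
    have e₂ : ∫ x, fderiv ℝ g x (G₂ x) ∂H = c * (g q - g p) := by
      have : ∀ x, fderiv ℝ g x (G₂ x) = Γ.indicator (fun x => c * fderiv ℝ g x (ξ₀ x)) x := by
        intro x
        by_cases h : x ∈ Γ <;> simp [hG₂, h]
      simp_rw [this]
      rw [integral_indicator hΓm, integral_const_mul, ← hbd g hg1]
      congr 1
      refine setIntegral_congr_ae hΓm ?_
      filter_upwards [hM2, hΓae] with x hx hxΓ h
      rw [(hx (hxΓ h)).2.1]
    have e₃ : ∫ x, fderiv ℝ g x (G₃ x) ∂H = c * (g q - g p) := by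
      have : ∀ x, fderiv ℝ g x (G₃ x) = L.indicator (fun x => c * fderiv ℝ g x w) x := by
        intro x
        by_cases h : x ∈ L <;> simp [hG₃, h]
      simp_rw [this]
      rw [integral_indicator hLm, integral_const_mul, ← setIntegral_segment_fderiv hpq hg1]
    have hsum : ∀ x, fderiv ℝ g x (V x) =
        fderiv ℝ g x (G₁ x) - fderiv ℝ g x (G₂ x) + fderiv ℝ g x (G₃ x) := by
      intro x
      simp [hV]
    have i₁₂ : Integrable (fun x => fderiv ℝ g x (G₁ x) - fderiv ℝ g x (G₂ x)) H := i₁.sub i₂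
    simp_rw [hsum]
    rw [← hH, integral_add i₁₂ i₃, integral_sub i₁ i₂, e₁, e₂, e₃]
    ring
  set J : ℝ≥0∞ := ∫⁻ x in {x | V x ≠ 0}, ENNReal.ofReal (capacityCost α c ‖V x‖) ∂H with hJ
  have hIJ : I ≤ J := by
    have h := hT.2 S hSpath
    rw [hcostT] at h
    exact (ENNReal.mul_le_mul_iff_right hKpos ENNReal.ofReal_ne_top).1 h
  -- The heart of the surgery: exactly one unit of cost is lost on `Γ` and at most one is gained on
  -- `L`. Writing the loss on the left avoids subtraction in `ℝ≥0∞`.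
  have hpt : ∀ᵐ x ∂H, ENNReal.ofReal (capacityCost α c ‖V x‖) + Γ.indicator 1 x ≤
      M.indicator (fun x => ENNReal.ofReal (capacityCost α c (T.density x))) x +
        L.indicator 1 x := by
    filter_upwards [hM2, hΓae, hVM] with x hx hxΓ hxV
    by_cases hxM : x ∈ M
    · rw [hxV.1 hxM, indicator_of_mem hxM]
      have ha0 : 0 ≤ a x := by
        by_cases h : x ∈ Γ
        · simpa [ha, h] using hθ x h
        · simpa [ha, h] using T.density_nonneg x (hMsub hxM)
      have h1 : ENNReal.ofReal (capacityCost α c (T.density x)) =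
          ENNReal.ofReal (capacityCost α c (a x)) + Γ.indicator 1 x := by
        by_cases h : x ∈ Γ
        · have h2 : T.density x = a x + c := by simp [ha, h]
          rw [h2, capacityCost_add_self hc, ENNReal.ofReal_add (capacityCost_nonneg hc ha0)
            zero_le_one]
          simp [h]
        · simp [ha, h]
      have h2 : ENNReal.ofReal (capacityCost α c ‖a x • ξ₀ x + L.indicator (fun _ => c • w) x‖) ≤
          ENNReal.ofReal (capacityCost α c (a x)) + L.indicator 1 x := by
        by_cases h : x ∈ L
        · obtain ⟨r, hr⟩ := (hx hxM).2.2.2.2 h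
          rw [indicator_of_mem h, indicator_of_mem h, Pi.one_apply, ← ENNReal.ofReal_one,
            ← ENNReal.ofReal_add (capacityCost_nonneg hc ha0) zero_le_one]
          exact ENNReal.ofReal_le_ofReal
            (capacityCost_norm_smul_add_le hα hc ha0 (hx hxM).2.2.1 hw1 hr)
        · rw [indicator_of_notMem h, indicator_of_notMem h, add_zero, add_zero, norm_smul,
            (hx hxM).2.2.1, mul_one, Real.norm_of_nonneg ha0]
      rw [h1, add_right_comm]
      gcongr
    · have h : x ∉ Γ := fun h => hxM (hxΓ h)
      rw [hxV.2 hxM, indicator_of_notMem hxM, indicator_of_notMem h]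
      by_cases h : x ∈ L
      · simp [h, norm_smul, hw1, abs_of_pos hc, capacityCost_self hc]
      · simp [h]
  have hfinal : J + H Γ ≤ I + H L := by
    calc J + H Γ ≤ (∫⁻ x, ENNReal.ofReal (capacityCost α c ‖V x‖) ∂H) +
          ∫⁻ x, Γ.indicator 1 x ∂H := by
          rw [lintegral_indicator_one hΓm]
          gcongr
          exact setLIntegral_le_lintegral _ _
      _ = ∫⁻ x, ENNReal.ofReal (capacityCost α c ‖V x‖) + Γ.indicator 1 x ∂H :=
          (lintegral_add_right _ (measurable_one.indicator hΓm)).symm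
      _ ≤ _ := lintegral_mono_ae hpt
      _ = I + H L := by
          rw [lintegral_add_right _ (measurable_one.indicator hLm), lintegral_indicator_one hLm,
            lintegral_indicator hMm]
  rw [← hLlen]
  exact (ENNReal.add_le_add_iff_left hIfin).1 ((add_le_add_left hIJ _).trans hfinal)

end RectifiableCurrent

/-! ### Curves of constant direction -/

section Direction

theorem HasStrictDerivAt.exists_mul_abs_sub_le {E : Type*} [NormedAddCommGroup E]
    [NormedSpace ℝ E] {γ : ℝ → E} {v : E} {t : ℝ} (h : HasStrictDerivAt γ v t) (hv : v ≠ 0) :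
    ∃ k > 0, ∃ δ > 0, ∀ x y, |x - t| < δ → |y - t| < δ → k * |x - y| ≤ ‖γ x - γ y‖ := by
  have hk : 0 < ‖v‖ / 2 := by positivity
  have h1 := h.hasStrictFDerivAt.isLittleO.def hk
  obtain ⟨δ, hδ, h2⟩ := Metric.eventually_nhds_iff.1 h1
  refine ⟨‖v‖ / 2, hk, δ, hδ, fun x y hx hy => ?_⟩
  have h3 : ‖γ x - γ y - (x - y) • v‖ ≤ ‖v‖ / 2 * |x - y| := by
    have := @h2 (x, y) (by simp [Prod.dist_eq, Real.dist_eq, hx, hy])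
    simpa using this
  have h4 : ‖(x - y) • v‖ ≤ ‖γ x - γ y‖ + ‖γ x - γ y - (x - y) • v‖ := by
    simpa using norm_sub_le (γ x - γ y) (γ x - γ y - (x - y) • v)
  rw [norm_smul, Real.norm_eq_abs] at h4
  linarith

variable {E : Type*} [NormedAddCommGroup E] [InnerProductSpace ℝ E]

/-- A `C¹` arc no longer than its chord runs in the direction of the chord. -/
theorem norm_smul_eq_of_integral_norm_le {γ γ' : ℝ → E} {a b : ℝ} (hab : a < b)
    (hd : ∀ s ∈ Icc a b, HasDerivAt γ (γ' s) s) (hc : ContinuousOn γ' (Icc a b))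
    (hne : γ a ≠ γ b) (hle : ∫ s in a..b, ‖γ' s‖ ≤ ‖γ b - γ a‖) {s : ℝ} (hs : s ∈ Icc a b) :
    ‖γ' s‖ • (‖γ b - γ a‖⁻¹ • (γ b - γ a)) = γ' s := by
  set u : E := ‖γ b - γ a‖⁻¹ • (γ b - γ a) with hu
  have hba : γ b - γ a ≠ 0 := sub_ne_zero.2 hne.symm
  have hu1 : ‖u‖ = 1 := norm_smul_inv_norm hba
  have hi : ∀ s, inner ℝ u (γ' s) ≤ ‖γ' s‖ := fun s => by
    simpa [hu1] using real_inner_le_norm u (γ' s)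
  have hinner : ContinuousOn (fun s => inner ℝ u (γ' s)) (Icc a b) :=
    ContinuousOn.inner continuousOn_const hc
  have hint : ∫ s in a..b, inner ℝ u (γ' s) = ‖γ b - γ a‖ := by
    rw [intervalIntegral.integral_eq_sub_of_hasDerivAt (f := fun s => inner ℝ u (γ s))]
    · rw [← inner_sub_right, hu, real_inner_smul_left, real_inner_self_eq_norm_sq, pow_two,
        inv_mul_cancel_left₀ (norm_ne_zero_iff.2 hba)]
    · intro s hs
      rw [uIcc_of_le hab.le] at hs
      simpa using (hasDerivAt_const s u).inner ℝ (hd s hs)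
    · exact hinner.intervalIntegrable_of_Icc hab.le
  -- A strict Cauchy-Schwarz inequality at one parameter would persist nearby by continuity and make
  -- the length exceed the chord.
  have key : inner ℝ u (γ' s) = ‖u‖ * ‖γ' s‖ := by
    rw [hu1, one_mul]
    by_contra hcon
    have hpos : 0 < ∫ s in a..b, (‖γ' s‖ - inner ℝ u (γ' s)) :=
      intervalIntegral.integral_pos hab (hc.norm.sub hinner) (fun s _ => sub_nonneg.2 (hi s))
        ⟨s, hs, sub_pos.2 (lt_of_le_of_ne (hi s) hcon)⟩
    rw [intervalIntegral.integral_sub (hc.norm.intervalIntegrable_of_Icc hab.le)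
      (hinner.intervalIntegrable_of_Icc hab.le), hint] at hpos
    linarith
  rw [inner_eq_norm_mul_iff_real.1 key, hu1, one_smul]

/-- A curve whose velocity has a fixed direction parametrizes a segment. -/
theorem image_Icc_eq_segment_of_direction [CompleteSpace E] {γ : ℝ → E} (hγ : ContinuousOn γ (Icc 0 1)) {u : E}
    (hu : ‖u‖ = 1) {γ' : ℝ → E} (hd : ∀ t ∈ Ioo (0 : ℝ) 1, HasDerivAt γ (γ' t) t)
    (hdir : ∀ t ∈ Ioo (0 : ℝ) 1, ‖γ' t‖ • u = γ' t) :
    γ '' Icc 0 1 = segment ℝ (γ 0) (γ 1) := by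
  set g : ℝ → ℝ := fun t => inner ℝ u (γ t - γ 0) with hg
  have hg0 : g 0 = 0 := by simp [hg]
  have hsub : ContinuousOn (fun t => γ t - γ 0) (Icc 0 1) := hγ.sub continuousOn_const
  have hgc : ContinuousOn g (Icc 0 1) := ContinuousOn.inner continuousOn_const hsub
  have hin : ∀ t ∈ Ioo (0 : ℝ) 1, inner ℝ u (γ' t) = ‖γ' t‖ := by
    intro t ht
    conv_lhs => rw [← hdir t ht]
    rw [real_inner_smul_right, real_inner_self_eq_norm_sq, hu]
    ring
  have hgd : ∀ t ∈ Ioo (0 : ℝ) 1, HasDerivAt g ‖γ' t‖ t := by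
    intro t ht
    have := (hasDerivAt_const t u).inner ℝ ((hd t ht).sub_const (γ 0))
    rw [hin t ht] at this
    simpa using this
  have hmono : MonotoneOn g (Icc 0 1) := by
    refine monotoneOn_of_deriv_nonneg (convex_Icc 0 1) hgc ?_ ?_ <;> rw [interior_Icc]
    · exact fun t ht => (hgd t ht).differentiableAt.differentiableWithinAt
    · intro t ht
      rw [(hgd t ht).deriv]
      exact norm_nonneg _
  have hline : ∀ t ∈ Icc (0 : ℝ) 1, γ t = γ 0 + g t • u := by
    intro t ht
    have hsubset : Icc 0 t ⊆ Icc (0 : ℝ) 1 := Icc_subset_Icc_right ht.2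
    have h := integral_eq_of_hasDerivAt_off_countable_of_le
      (fun t => (γ t - γ 0) - g t • u) (fun _ => 0) ht.1 countable_empty
      ((hsub.mono hsubset).sub ((hgc.mono hsubset).smul continuousOn_const))
      (fun x hx => ?_) (by simp)
    · simp only [intervalIntegral.integral_zero, sub_self, hg0, zero_smul, sub_zero] at h
      rw [← sub_eq_zero.1 h.symm]
      abel
    · have hx' : x ∈ Ioo (0 : ℝ) 1 := ⟨hx.1.1, hx.1.2.trans_le ht.2⟩
      have h := ((hd x hx').sub_const (γ 0)).sub ((hgd x hx').smul_const u)
      rwa [hdir x hx', sub_self] at h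
  have h0 : (0 : ℝ) ∈ Icc (0 : ℝ) 1 := left_mem_Icc.2 zero_le_one
  have h1 : (1 : ℝ) ∈ Icc (0 : ℝ) 1 := right_mem_Icc.2 zero_le_one
  have hend : γ 1 - γ 0 = g 1 • u := by
    rw [hline 1 h1]
    abel
  rw [segment_eq_image', hend]
  apply Subset.antisymm
  · rintro _ ⟨t, ht, rfl⟩
    have hgt0 : 0 ≤ g t := hg0 ▸ hmono h0 ht ht.1
    have hgt1 : g t ≤ g 1 := hmono ht h1 ht.2
    -- The case `g 1 = 0` is allowed, since `γ'` may vanish here; monotonicity then forces `g t = 0`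
    -- and the junk quotient does no harm.
    refine ⟨g t / g 1, ⟨div_nonneg hgt0 (hgt0.trans hgt1), div_le_one_of_le₀ hgt1
      (hgt0.trans hgt1)⟩, ?_⟩
    simp only
    rw [hline t ht, smul_smul, div_mul_cancel_of_imp fun h => le_antisymm (h ▸ hgt1) hgt0]
  · rintro _ ⟨r, hr, rfl⟩
    have hg1 : 0 ≤ g 1 := hg0 ▸ hmono h0 h1 zero_le_one
    have hmem : r * g 1 ∈ Icc (g 0) (g 1) := by
      rw [hg0]
      exact ⟨mul_nonneg hr.1 hg1, mul_le_of_le_one_left hg1 hr.2⟩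
    obtain ⟨t, ht, htr⟩ := intermediate_value_Icc zero_le_one hgc hmem
    refine ⟨t, ht, ?_⟩
    simp only
    rw [hline t ht, htr, smul_smul]

end Direction

/-! ### Straightness of consistently oriented arcs -/

namespace RectifiableCurrent

variable {m : ℕ} {α c : ℝ} {μm μp : Measure (EuclideanSpace ℝ (Fin m))}

/-- An arc of an optimal current with density at least `c`, consistently oriented by the current,
is straight. -/
theorem IsOptimal.exists_direction_of_arc (hα : 0 ≤ α) (hc : 0 < c) {T : RectifiableCurrent m}
    (hT : T.IsOptimal α c μm μp) (hfin : T.cost α c ≠ ∞)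
    {γ γ' : ℝ → EuclideanSpace ℝ (Fin m)} {a b k : ℝ} (hab : a < b)
    (hd : ∀ s ∈ Icc a b, HasStrictDerivAt γ (γ' s) s) (hγ'c : ContinuousOn γ' (Icc a b))
    (h0 : ∀ s ∈ Icc a b, γ' s ≠ 0) (hk : 0 < k)
    (hanti : ∀ x ∈ Icc a b, ∀ y ∈ Icc a b, k * |x - y| ≤ ‖γ x - γ y‖)
    (hM : MapsTo γ (Icc a b) T.carrier) (hθ : ∀ s ∈ Icc a b, c ≤ T.density (γ s))
    {ε : ℝ} (hε : ε = 1 ∨ ε = -1)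
    (hor : ∀ᵐ s ∂volume.restrict (Icc a b), 0 < ε * inner ℝ (T.orient (γ s)) (γ' s)) :
    ∃ u, ∀ s ∈ Icc a b, ‖γ' s‖⁻¹ • γ' s = u := by
  have hγc : ContinuousOn γ (Icc a b) := fun s hs =>
    (hd s hs).hasDerivAt.continuousAt.continuousWithinAt
  have hne : γ a ≠ γ b := by
    intro h
    have := hanti a (left_mem_Icc.2 hab.le) b (right_mem_Icc.2 hab.le)
    rw [h, sub_self, norm_zero] at this
    have h2 : 0 < |a - b| := abs_pos.2 (sub_ne_zero.2 hab.ne)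
    nlinarith
  set Γ := γ '' Icc a b with hΓ
  have hΓM : Γ ⊆ T.carrier := hM.image_subset
  have hΓm : MeasurableSet Γ := (isCompact_Icc.image_of_continuousOn hγc).isClosed.measurableSet
  have harea := hausdorffMeasure_restrict_image_Icc hd hγ'c hk hanti
  have hγm := aemeasurable_speedMeasure (γ' := γ') hγc
  -- A unit vector parallel to `γ' s` is determined by the sign of its inner product with `γ' s`.
  have hξ : ∀ᵐ s ∂volume.restrict (Icc a b), ‖γ' s‖ • T.orient (γ s) = ε • γ' s := by
    have h1 := ae_restrict_of_ae_restrict_of_subset hΓM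
      (T.isUnitTangentField.ae_tangent_curve (fun s hs => (hd s hs).hasDerivAt) h0)
    rw [harea] at h1
    have h2 := (ae_speedMeasure_iff hγ'c h0).1 (ae_of_ae_map hγm h1)
    filter_upwards [h2, hor, ae_restrict_mem measurableSet_Icc] with s ⟨hs1, hs2⟩ hs3 hs
    obtain ⟨r, hr⟩ := hs2 s hs rfl
    have hpos : 0 < ‖γ' s‖ := norm_pos_iff.2 (h0 s hs)
    rw [hr, norm_smul, Real.norm_eq_abs] at hs1
    rw [hr, real_inner_smul_left, real_inner_self_eq_norm_sq] at hs3
    rw [hr, smul_smul]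
    congr 1
    rcases hε with rfl | rfl
    · have hr0 : 0 < r := by
        by_contra h
        have : r * ‖γ' s‖ ^ 2 ≤ 0 := mul_nonpos_of_nonpos_of_nonneg (not_lt.1 h) (sq_nonneg _)
        linarith
      rw [abs_of_pos hr0] at hs1
      linarith
    · have hr0 : r < 0 := by
        by_contra h
        have : 0 ≤ r * ‖γ' s‖ ^ 2 := mul_nonneg (not_lt.1 h) (sq_nonneg _)
        linarith
      rw [abs_of_neg hr0] at hs1
      linarith
  have hbd : ∀ f : EuclideanSpace ℝ (Fin m) → ℝ, ContDiff ℝ 1 f →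
      ∫ x in Γ, fderiv ℝ f x (T.orient x) ∂(Measure.hausdorffMeasure 1) =
        ε * (f (γ b) - f (γ a)) := fun f hf =>
    setIntegral_image_fderiv hd hγ'c hab.le hk hanti
      (T.aestronglyMeasurable_orient.mono_measure (Measure.restrict_mono hΓM le_rfl)) hξ hf
  have hθΓ : ∀ x ∈ Γ, c ≤ T.density x := by
    rintro _ ⟨s, hs, rfl⟩
    exact hθ s hs
  -- When `ε = -1` the current flows from `γ b` to `γ a`, so the endpoints of the replacement
  -- segment are exchanged.
  have hlen : Measure.hausdorffMeasure 1 Γ ≤ edist (γ a) (γ b) := by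
    rcases hε with rfl | rfl
    · exact hT.hausdorffMeasure_le_edist hα hc hfin hΓm hΓM hθΓ hne fun f hf => by
        rw [hbd f hf, one_mul]
    · rw [edist_comm]
      exact hT.hausdorffMeasure_le_edist hα hc hfin hΓm hΓM hθΓ hne.symm fun f hf => by
        rw [hbd f hf]
        ring
  have hΓlen : Measure.hausdorffMeasure 1 Γ = ENNReal.ofReal (∫ s in a..b, ‖γ' s‖) := by
    rw [← Measure.restrict_apply_univ, harea, Measure.map_apply_of_aemeasurable hγm
      MeasurableSet.univ, preimage_univ, speedMeasure, withDensity_apply _ MeasurableSet.univ,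
      Measure.restrict_univ, intervalIntegral.integral_of_le hab.le,
      ← integral_Icc_eq_integral_Ioc, ofReal_integral_eq_lintegral_ofReal]
    · exact hγ'c.norm.integrableOn_Icc
    · exact Eventually.of_forall fun _ => norm_nonneg _
  rw [hΓlen, edist_comm, edist_dist, ENNReal.ofReal_le_ofReal_iff dist_nonneg, dist_eq_norm] at hlen
  refine ⟨‖γ b - γ a‖⁻¹ • (γ b - γ a), fun s hs => ?_⟩
  rw [inv_smul_eq_iff₀ (norm_ne_zero_iff.2 (h0 s hs))]
  exact (norm_smul_eq_of_integral_norm_le hab (fun s hs => (hd s hs).hasDerivAt) hγ'c hne hlen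
    hs).symm

end RectifiableCurrent

/-! ### Gluing the local directions -/

theorem mainTheorem4 {m : ℕ} (α c : ℝ) (hα₀ : 0 ≤ α) (hα₁ : α ≤ 1) (hc : 0 < c)
    (μm μp : Measure (EuclideanSpace ℝ (Fin m))) [IsFiniteMeasure μm] [IsFiniteMeasure μp]
    (hμ : μm univ = μp univ)
    (T : RectifiableCurrent m) (hT : T.IsOptimal α c μm μp) (hfin : T.cost α c ≠ ∞)
    (v₁ v₂ : EuclideanSpace ℝ (Fin m)) (γ₀ : ℝ → EuclideanSpace ℝ (Fin m))
    (hγ₀ : γ₀ ∈ T.regularCurves v₁ v₂) (hrev : T.ReversesFinitelyOften γ₀)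
    (θ₀ : ℕ) (hθ₀ : 0 < θ₀)
    (hmin : IsLeast ((fun t => T.density (γ₀ t) / c) '' Icc (0 : ℝ) 1) (θ₀ : ℝ)) :
    γ₀ '' Icc (0 : ℝ) 1 = segment ℝ v₁ v₂ := by
  obtain ⟨hcont, hC1, hmaps, rfl, rfl, hreg⟩ := hγ₀
  obtain ⟨F, hF, hsign⟩ := hrev
  have hstrict : ∀ s ∈ Ioo (0 : ℝ) 1, HasStrictDerivAt γ₀ (deriv γ₀ s) s := fun s hs =>
    (hC1.contDiffAt (isOpen_Ioo.mem_nhds hs)).hasStrictDerivAt one_ne_zero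
  have hderivc : ContinuousOn (deriv γ₀) (Ioo 0 1) :=
    hC1.continuousOn_deriv_of_isOpen isOpen_Ioo le_rfl
  have hθ : ∀ s ∈ Icc (0 : ℝ) 1, c ≤ T.density (γ₀ s) := by
    intro s hs
    have h1 : (θ₀ : ℝ) ≤ T.density (γ₀ s) / c := hmin.2 ⟨s, hs, rfl⟩
    have h2 : (1 : ℝ) ≤ θ₀ := by exact_mod_cast hθ₀
    have h3 := h2.trans h1
    rwa [le_div_iff₀ hc, one_mul] at h3
  set d : ℝ → EuclideanSpace ℝ (Fin m) := fun s => ‖deriv γ₀ s‖⁻¹ • deriv γ₀ s with hd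
  have hdc : ContinuousOn d (Ioo 0 1) :=
    (hderivc.norm.inv₀ fun s hs => norm_ne_zero_iff.2 (hreg s hs)).smul hderivc
  have hloc : ∀ t ∈ Ioo (0 : ℝ) 1 \ F, HasDerivAt d 0 t := by
    rintro t ⟨ht, htF⟩
    obtain ⟨δ, hδ, hs⟩ := hsign t ⟨ht, htF⟩
    obtain ⟨k, hk, ρ, hρ, hanti⟩ := (hstrict t ht).exists_mul_abs_sub_le (hreg t ht)
    -- The radius keeps the arc inside `(0, 1)`, within the range `δ` of constant sign, and within
    -- the range `ρ` where `γ₀` is injective with a Lipschitz inverse.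
    obtain ⟨r, hr, hrlt⟩ := exists_between
      (show 0 < min (min t (1 - t)) (min δ ρ) from
        lt_min (lt_min ht.1 (sub_pos.2 ht.2)) (lt_min hδ hρ))
    obtain ⟨hr1, hr2⟩ := lt_min_iff.1 hrlt
    obtain ⟨hrt, hrt'⟩ := lt_min_iff.1 hr1
    obtain ⟨hrδ, hrρ⟩ := lt_min_iff.1 hr2
    have habs : ∀ s ∈ Icc (t - r) (t + r), |s - t| ≤ r := fun s hs => by
      rw [abs_le]
      constructor <;> linarith [hs.1, hs.2]
    have hI : Icc (t - r) (t + r) ⊆ Ioo 0 1 := fun s hs =>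
      ⟨by linarith [hs.1], by linarith [hs.2]⟩
    have hor : ∃ ε : ℝ, (ε = 1 ∨ ε = -1) ∧ ∀ᵐ s ∂volume.restrict (Icc (t - r) (t + r)),
        0 < ε * inner ℝ (T.orient (γ₀ s)) (deriv γ₀ s) := by
      rcases hs with hs | hs
      · refine ⟨1, Or.inl rfl, (ae_restrict_iff' measurableSet_Icc).2 ?_⟩
        filter_upwards [hs] with s h hsI
        simpa using h (hI hsI) ((habs s hsI).trans_lt hrδ)
      · refine ⟨-1, Or.inr rfl, (ae_restrict_iff' measurableSet_Icc).2 ?_⟩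
        filter_upwards [hs] with s h hsI
        simpa using h (hI hsI) ((habs s hsI).trans_lt hrδ)
    obtain ⟨ε, hε, hor⟩ := hor
    obtain ⟨u, hu⟩ := hT.exists_direction_of_arc hα₀ hc hfin (by linarith : t - r < t + r)
      (fun s hs => hstrict s (hI hs)) (hderivc.mono hI) (fun s hs => hreg s (hI hs)) hk
      (fun x hx y hy => hanti x y ((habs x hx).trans_lt hrρ) ((habs y hy).trans_lt hrρ))
      (fun s hs => hmaps (Ioo_subset_Icc_self (hI hs)))
      (fun s hs => hθ s (Ioo_subset_Icc_self (hI hs))) hε hor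
    refine (hasDerivAt_const t u).congr_of_eventuallyEq ?_
    filter_upwards [Icc_mem_nhds (by linarith : t - r < t) (by linarith : t < t + r)] with s hs
    exact hu s hs
  -- Reversals of `ξ` do not bend the curve: `d` is continuous across `F`, and a zero derivative off
  -- a countable set suffices for constancy.
  have hconst : ∀ x ∈ Ioo (0 : ℝ) 1, ∀ y ∈ Ioo (0 : ℝ) 1, x ≤ y → d x = d y := by
    intro x hx y hy hxy
    have h := integral_eq_of_hasDerivAt_off_countable_of_le d (fun _ => 0) hxy hF.countable
      (hdc.mono (Icc_subset_Ioo hx.1 hy.2))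
      (fun s hs => hloc s ⟨⟨hx.1.trans hs.1.1, hs.1.2.trans hy.2⟩, hs.2⟩) (by simp)
    rw [intervalIntegral.integral_zero] at h
    exact (sub_eq_zero.1 h.symm).symm
  have hhalf : (1 / 2 : ℝ) ∈ Ioo (0 : ℝ) 1 := by norm_num
  refine image_Icc_eq_segment_of_direction hcont (u := d (1 / 2))
    (norm_smul_inv_norm (hreg _ hhalf)) (fun t ht => (hstrict t ht).hasDerivAt) fun t ht => ?_
  have h : d (1 / 2) = d t := by
    rcases le_total t (1 / 2) with h | h
    · exact (hconst t ht _ hhalf h).symm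
    · exact hconst _ hhalf t ht h
  rw [h, hd, smul_smul, mul_inv_cancel₀ (norm_ne_zero_iff.2 (hreg t ht)), one_smul]
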